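/- Let $\mathbf a$ be a Turing degree such that $\mathbf a\vee\mathbf 0'\ge_T\mathbf 0''$. Then for every set $B\subseteq\omega$ with $B\in\mathbf a$: (1) there is a set $A\in\mathbf a$ with $A\le_{uT(tu)}B$, that is, there is a Turing reduction $\Phi^B=A$ whose use function is dominated by every order function; (2) $B$ is wtt-equivalent to some dominant function $f\colon\omega\to\omega$, that is, to a function that dominates every recursive function. Here an order function is a recursive, nondecreasing, unbounded function $h\colon\omega\to\omega$; a function $f$ dominates a function $g$ if $g(n)\le f(n)$ for all but finitely many $n$; the use function of a reduction $\Phi^B=A$ assigns to $n$ the number $m+1$, where $m$ is the largest number queried by $\Phi$ in computing $A(0),\dots,A(n-1)$ (and $0$ if there are no queries); and $f\le_{wtt}g$ means that $f$ is computable by a Turing reduction with oracle $g$ whose use function is bounded by a recursive function ($f,g$ functions $\omega\to\omega$, sets being identified with their characteristic functions). -/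

import Mathlib

/-- Programs for oracle computations. The constructors are those of `Nat.RecursiveIn`;
`oracle` is the instruction which queries the oracle at the current input. -/
inductive OracleCode : Type
  | zero : OracleCode
  | succ : OracleCode
  | left : OracleCode
  | right : OracleCode
  | oracle : OracleCode
  | pair : OracleCode → OracleCode → OracleCode
  | comp : OracleCode → OracleCode → OracleCode
  | prec : OracleCode → OracleCode → OracleCode
  | rfind : OracleCode → OracleCode

namespace OracleCode

/-- The Gödel number of a program. -/
def encode : OracleCode → ℕ
  | zero => 0
  | succ => 1
  | left => 2
  | right => 3
  | oracle => 4
  | pair c d => 4 * Nat.pair (encode c) (encode d) + 5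
  | comp c d => 4 * Nat.pair (encode c) (encode d) + 6
  | prec c d => 4 * Nat.pair (encode c) (encode d) + 7
  | rfind c => 4 * encode c + 8

theorem encode_injective : Function.Injective encode := by
  intro c
  induction c with
  | zero | succ | left | right | oracle =>
    intro d h; cases d <;> simp only [encode] at h <;> first | rfl | omega
  | pair c d ihc ihd | comp c d ihc ihd | prec c d ihc ihd =>
    intro e h
    cases e <;> simp only [encode] at h <;> first
      | omega
      | (have h' := Nat.pair_eq_pair.1 (Nat.eq_of_mul_eq_mul_left four_pos (Nat.add_right_cancel h))
         rw [ihc h'.1, ihd h'.2])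
  | rfind c ih =>
    intro e h
    cases e <;> simp only [encode] at h <;> first
      | omega
      | rw [ih (Nat.eq_of_mul_eq_mul_left four_pos (Nat.add_right_cancel h))]

/-- The partial function computed by a program with oracle `X`. -/
def eval (X : ℕ → ℕ) : OracleCode → ℕ →. ℕ
  | zero => fun _ => Part.some 0
  | succ => fun n => Part.some (n + 1)
  | left => fun n => Part.some n.unpair.1
  | right => fun n => Part.some n.unpair.2
  | oracle => fun n => Part.some (X n)
  | pair c d => fun n => Nat.pair <$> eval X c n <*> eval X d n
  | comp c d => fun n => eval X d n >>= eval X c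
  | prec c d => fun p =>
      let (a, n) := Nat.unpair p
      n.rec (eval X c a) fun y IH => do
        let i ← IH
        eval X d (Nat.pair a (Nat.pair y i))
  | rfind c => fun a => Nat.rfind fun n => (fun m => m = 0) <$> eval X c (Nat.pair a n)

/-- The set of numbers at which the oracle `X` is queried while the program runs on a given
input (for a run which halts). -/
def queries (X : ℕ → ℕ) : OracleCode → ℕ → Set ℕ
  | zero, _ => ∅
  | succ, _ => ∅
  | left, _ => ∅
  | right, _ => ∅
  | oracle, n => {n}
  | pair c d, n => queries X c n ∪ queries X d n
  | comp c d, n => queries X d n ∪ {q | ∃ m ∈ eval X d n, q ∈ queries X c m}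
  | prec c d, p => queries X c p.unpair.1 ∪
      {q | ∃ y < p.unpair.2, ∃ i ∈ eval X (prec c d) (Nat.pair p.unpair.1 y),
        q ∈ queries X d (Nat.pair p.unpair.1 (Nat.pair y i))}
  | rfind c, a => {q | ∃ n, (∀ k < n, ∃ m ∈ eval X c (Nat.pair a k), m ≠ 0) ∧
      q ∈ queries X c (Nat.pair a n)}

/-- The use function: `use X c n` is `q + 1`, where `q` is the largest number queried by `c`
during the computations with inputs `0, ..., n - 1`, and `0` if there are no queries.
By `queries_finite`, the supremum is over a finite set whenever these computations halt. -/
noncomputable def use (X : ℕ → ℕ) (c : OracleCode) (n : ℕ) : ℕ :=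
  sSup {u | ∃ m < n, ∃ q ∈ queries X c m, u = q + 1}

/-- The program `c` with oracle `X` computes the total function `f`. -/
def Computes (X : ℕ → ℕ) (c : OracleCode) (f : ℕ → ℕ) : Prop :=
  ∀ n, eval X c n = Part.some (f n)

theorem eval_prec_succ (X : ℕ → ℕ) (c d : OracleCode) (a y : ℕ) :
    eval X (prec c d) (Nat.pair a (y + 1)) =
      eval X (prec c d) (Nat.pair a y) >>= fun i => eval X d (Nat.pair a (Nat.pair y i)) := by
  simp [eval]

theorem queries_finite (X : ℕ → ℕ) (c : OracleCode) :
    ∀ n, (eval X c n).Dom → (queries X c n).Finite := by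
  induction c with
  | zero | succ | left | right | oracle => intro n _; simp [queries]
  | pair c d ihc ihd =>
    intro n h
    obtain ⟨v, hv⟩ := Part.dom_iff_mem.1 h
    simp only [eval, Seq.seq, Part.map_eq_map, Part.mem_bind_iff, Part.mem_map_iff] at hv
    obtain ⟨_, ⟨x, hx, _⟩, y, hy, _⟩ := hv
    exact (ihc n (Part.dom_iff_mem.2 ⟨x, hx⟩)).union (ihd n (Part.dom_iff_mem.2 ⟨y, hy⟩))
  | comp c d ihc ihd =>
    intro n h
    obtain ⟨v, hv⟩ := Part.dom_iff_mem.1 h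
    obtain ⟨x, hx, hv⟩ := Part.mem_bind_iff.1 hv
    refine (ihd n (Part.dom_iff_mem.2 ⟨x, hx⟩)).union
      ((ihc x (Part.dom_iff_mem.2 ⟨v, hv⟩)).subset ?_)
    rintro q ⟨m, hm, hq⟩
    rwa [Part.mem_unique hm hx] at hq
  | prec c d ihc ihd =>
    intro p h
    obtain ⟨a, n, rfl⟩ : ∃ a n, Nat.pair a n = p := ⟨_, _, Nat.pair_unpair p⟩
    induction n with
    | zero =>
      refine (ihc a (by simpa [eval] using h)).subset ?_
      rintro q (hq | ⟨y, hy, _⟩)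
      · simpa using hq
      · simp at hy
    | succ n ih =>
      rw [eval_prec_succ] at h
      obtain ⟨v, hv⟩ := Part.dom_iff_mem.1 h
      simp only [Part.bind_eq_bind, Part.mem_bind_iff] at hv
      obtain ⟨i, hi, hv⟩ := hv
      refine ((ih (Part.dom_iff_mem.2 ⟨i, hi⟩)).union
        (ihd _ (Part.dom_iff_mem.2 ⟨v, hv⟩))).subset ?_
      rintro q (hq | ⟨y, hy, j, hj, hq⟩)
      · left; left; simpa using hq
      · simp only [Nat.unpair_pair] at hy hj hq
        rcases Nat.lt_succ_iff_lt_or_eq.1 hy with hy | rfl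
        · left; right; exact ⟨y, by simpa using hy, j, by simpa using hj, by simpa using hq⟩
        · right; rwa [Part.mem_unique hj hi] at hq
  | rfind c ih =>
    intro a h
    obtain ⟨v, hv⟩ := Part.dom_iff_mem.1 h
    obtain ⟨hv, hlt⟩ := Nat.mem_rfind.1 hv
    obtain ⟨x, hx, hx0⟩ := (Part.mem_map_iff _).1 hv
    have hdom : ∀ n ≤ v, (eval X c (Nat.pair a n)).Dom := by
      intro n hn
      rcases hn.lt_or_eq with hn | rfl
      · obtain ⟨y, hy, _⟩ := (Part.mem_map_iff _).1 (hlt hn)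
        exact Part.dom_iff_mem.2 ⟨y, hy⟩
      · exact Part.dom_iff_mem.2 ⟨x, hx⟩
    refine ((Set.finite_Iic v).biUnion fun n hn => ih _ (hdom n hn)).subset ?_
    rintro q ⟨n, hn, hq⟩
    refine Set.mem_biUnion (x := n) ?_ hq
    by_contra hlt'
    obtain ⟨m, hm, hm0⟩ := hn v (not_le.1 hlt')
    exact hm0 ((Part.mem_unique hm hx).trans (of_decide_eq_true hx0))

/-- Programs with oracle `X` compute exactly the partial functions recursive in `X`. -/
theorem exists_code_iff (X : ℕ → ℕ) (f : ℕ →. ℕ) :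
    (∃ c : OracleCode, eval X c = f) ↔ TuringReducible f (X : ℕ →. ℕ) := by
  rw [TuringReducible, RecursiveIn.iff_nat]
  constructor
  · rintro ⟨c, rfl⟩
    induction c with
    | zero => exact .zero
    | succ => exact .succ
    | left => exact .left
    | right => exact .right
    | oracle => exact .oracle _ rfl
    | pair c d ihc ihd => exact .pair ihc ihd
    | comp c d ihc ihd => exact .comp ihc ihd
    | prec c d ihc ihd => exact .prec ihc ihd
    | rfind c ih => exact .rfind ih
  · intro h
    induction h with
    | zero => exact ⟨zero, rfl⟩
    | succ => exact ⟨succ, rfl⟩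
    | left => exact ⟨left, rfl⟩
    | right => exact ⟨right, rfl⟩
    | oracle g hg => rw [Set.mem_singleton_iff.1 hg]; exact ⟨oracle, rfl⟩
    | pair _ _ ihc ihd =>
      obtain ⟨c, rfl⟩ := ihc; obtain ⟨d, rfl⟩ := ihd; exact ⟨pair c d, rfl⟩
    | comp _ _ ihc ihd =>
      obtain ⟨c, rfl⟩ := ihc; obtain ⟨d, rfl⟩ := ihd; exact ⟨comp c d, rfl⟩
    | prec _ _ ihc ihd =>
      obtain ⟨c, rfl⟩ := ihc; obtain ⟨d, rfl⟩ := ihd; exact ⟨prec c d, rfl⟩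
    | rfind _ ih => obtain ⟨c, rfl⟩ := ih; exact ⟨rfind c, rfl⟩

end OracleCode

open Classical in
/-- The characteristic function of a set of natural numbers. -/
noncomputable def charFn (A : Set ℕ) (n : ℕ) : ℕ := if n ∈ A then 1 else 0

/-- The Turing degree of a set. -/
noncomputable def degT (A : Set ℕ) : TuringDegree :=
  toAntisymmetrization TuringReducible (charFn A : ℕ →. ℕ)

theorem degT_le_degT_iff (A B : Set ℕ) :
    degT A ≤ degT B ↔ TuringReducible (charFn A : ℕ →. ℕ) (charFn B : ℕ →. ℕ) :=
  Iff.rfl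

/-- The Turing jump of a set: the numbers `e` such that the program with Gödel number `e` and
oracle `A` halts on input `e`. -/
def jump (A : Set ℕ) : Set ℕ :=
  {e | ∃ c : OracleCode, c.encode = e ∧ (c.eval (charFn A) e).Dom}

/-- An order function: a recursive, nondecreasing and unbounded function. -/
def IsOrder (h : ℕ → ℕ) : Prop :=
  Computable h ∧ Monotone h ∧ ¬ BddAbove (Set.range h)

/-- A function is dominant if it dominates every recursive function. -/
def IsDominant (f : ℕ → ℕ) : Prop :=
  ∀ g : ℕ → ℕ, Computable g → ∀ᶠ n in Filter.atTop, g n ≤ f n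

/-- Weak truth-table reducibility `f ≤_wtt g`: there is a Turing reduction of `f` to `g` whose
use function is bounded by a recursive function. -/
def WttReducible (f g : ℕ → ℕ) : Prop :=
  ∃ c : OracleCode, c.Computes g f ∧ ∃ h : ℕ → ℕ, Computable h ∧ ∀ n, c.use g n ≤ h n

/-- Weak truth-table equivalence. -/
def WttEquivalent (f g : ℕ → ℕ) : Prop :=
  WttReducible f g ∧ WttReducible g f

/-- `A ≤_{uT(tu)} B`: there is a Turing reduction of `A` to `B` whose use function is dominated
by every order function. -/
def UniformTinyUseReducible (A B : Set ℕ) : Prop :=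
  ∃ c : OracleCode, c.Computes (charFn B) (charFn A) ∧
    ∀ h : ℕ → ℕ, IsOrder h → ∀ᶠ n in Filter.atTop, c.use (charFn B) n ≤ h n

/-!
Write `K s` for the stage `s` approximation to `0'`. As `B ⊕ 0'` computes `0''`, some program `Γ`
decides from `B ⊕ 0'` which recursive functions are total. Given `B` below `n + 1`, search for a
stage `s` such that each program `e < n` which `Γ` takes for total on the approximate oracle
`B ⊕ K s` has halted on input `n` with output at most `s`. The search ends: if `e` is total, it
halts; if it is not, the approximations eventually stop claiming that it is. The stage found is a
dominant function of `n`, for if `e` is total then `Γ` says so on all good enough approximations.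
It is computed from `B` by queries up to `n`, and coding `B` into its parities makes it
wtt-equivalent to `B`.

Membership in the hypograph of an increasing dominant function `g` only requires the values of `g`
up to the point where they exceed the input, hence only queries up to the inverse of `g`, which
grows more slowly than every order function.
-/

open Filter
open Nat.Partrec (Code)

/-! ### Programs with controlled queries -/

namespace OracleCode

theorem eval_comp_of_eval {X : ℕ → ℕ} {d : OracleCode} {n m : ℕ} (c : OracleCode)
    (h : eval X d n = Part.some m) : eval X (comp c d) n = eval X c m := by
  simp only [eval, h]
  exact Part.bind_some _ _

theorem queries_comp_of_eval {X : ℕ → ℕ} {d : OracleCode} {n m : ℕ} (c : OracleCode)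
    (h : eval X d n = Part.some m) :
    queries X (comp c d) n = queries X d n ∪ queries X c m := by
  simp [queries, h]

theorem exists_eval_eq_of_partrec (X : ℕ → ℕ) {f : ℕ →. ℕ} (hf : Nat.Partrec f) :
    ∃ c, eval X c = f ∧ ∀ n, queries X c n = ∅ := by
  induction hf with
  | zero => exact ⟨zero, rfl, fun _ => rfl⟩
  | succ => exact ⟨succ, rfl, fun _ => rfl⟩
  | left => exact ⟨left, rfl, fun _ => rfl⟩
  | right => exact ⟨right, rfl, fun _ => rfl⟩
  | pair _ _ ihc ihd =>
    obtain ⟨c, rfl, hc⟩ := ihc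
    obtain ⟨d, rfl, hd⟩ := ihd
    exact ⟨pair c d, rfl, by simp [queries, hc, hd]⟩
  | comp _ _ ihc ihd =>
    obtain ⟨c, rfl, hc⟩ := ihc
    obtain ⟨d, rfl, hd⟩ := ihd
    exact ⟨comp c d, rfl, by simp [queries, hc, hd]⟩
  | prec _ _ ihc ihd =>
    obtain ⟨c, rfl, hc⟩ := ihc
    obtain ⟨d, rfl, hd⟩ := ihd
    exact ⟨prec c d, rfl, by simp [queries, hc, hd]⟩
  | rfind _ ih =>
    obtain ⟨c, rfl, hc⟩ := ih
    exact ⟨rfind c, rfl, by simp [queries, hc]⟩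

theorem use_le {X : ℕ → ℕ} {c : OracleCode} {n N : ℕ}
    (h : ∀ m < n, queries X c m ⊆ Set.Iio N) : use X c n ≤ N := by
  refine csSup_le' ?_
  rintro _ ⟨m, hm, q, hq, rfl⟩
  exact h m hm hq

end OracleCode

/-- The list of the first `n` values of `f`. -/
def initSeg {α : Type*} (f : ℕ → α) (n : ℕ) : List α := (List.range n).map f

section initSeg

variable {α : Type*} (f : ℕ → α)

theorem initSeg_succ (n : ℕ) : initSeg f (n + 1) = initSeg f n ++ [f n] := by
  simp [initSeg, List.range_succ]

theorem length_initSeg (n : ℕ) : (initSeg f n).length = n := by simp [initSeg]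

theorem take_initSeg {i n : ℕ} (h : i ≤ n) : (initSeg f n).take i = initSeg f i := by
  simp [initSeg, ← List.map_take, List.take_range, h]

theorem getElem?_initSeg_of_lt {i n : ℕ} (h : i < n) : (initSeg f n)[i]? = some (f i) := by
  simp [initSeg, h]

theorem getElem?_initSeg_of_le {i n : ℕ} (h : n ≤ i) : (initSeg f n)[i]? = none := by
  simp [initSeg, h]

end initSeg

/-- The function `f` is computed from the oracle `X` by a program all of whose queries on input
`n` lie in `U n`. Bounds on use functions are read off from `U`, so that programs can be combined
without naming them. -/
def ComputableWithQueries (X : ℕ → ℕ) (U : ℕ → Set ℕ) (f : ℕ → ℕ) : Prop :=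
  ∃ c : OracleCode, c.Computes X f ∧ ∀ n, c.queries X n ⊆ U n

namespace ComputableWithQueries

open OracleCode

variable {X f g : ℕ → ℕ} {U V : ℕ → Set ℕ}

theorem mono (hf : ComputableWithQueries X U f) (h : ∀ n, U n ⊆ V n) :
    ComputableWithQueries X V f := by
  obtain ⟨c, hc, hU⟩ := hf
  exact ⟨c, hc, fun n => (hU n).trans (h n)⟩

theorem oracle (X : ℕ → ℕ) : ComputableWithQueries X (fun n => {n}) X :=
  ⟨.oracle, fun _ => rfl, fun _ => subset_rfl⟩

theorem pair (hf : ComputableWithQueries X U f) (hg : ComputableWithQueries X V g) :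
    ComputableWithQueries X (fun n => U n ∪ V n) fun n => Nat.pair (f n) (g n) := by
  obtain ⟨c, hc, hU⟩ := hf
  obtain ⟨d, hd, hV⟩ := hg
  exact ⟨.pair c d, fun n => by simp [eval, hc n, hd n, Seq.seq],
    fun n => Set.union_subset_union (hU n) (hV n)⟩

theorem comp (hf : ComputableWithQueries X U f) (hg : ComputableWithQueries X V g) :
    ComputableWithQueries X (fun n => V n ∪ U (g n)) fun n => f (g n) := by
  obtain ⟨c, hc, hU⟩ := hf
  obtain ⟨d, hd, hV⟩ := hg
  refine ⟨.comp c d, fun n => by rw [eval_comp_of_eval c (hd n), hc], fun n => ?_⟩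
  rw [queries_comp_of_eval c (hd n)]
  exact Set.union_subset_union (hV n) (hU (g n))

theorem partrec_comp {φ : ℕ →. ℕ} (hφ : Nat.Partrec φ) (hf : ComputableWithQueries X U f)
    (h : ∀ n, φ (f n) = Part.some (g n)) : ComputableWithQueries X U g := by
  obtain ⟨c, hc, hU⟩ := hf
  obtain ⟨d, rfl, hd⟩ := exists_eval_eq_of_partrec X hφ
  refine ⟨.comp d c, fun n => by rw [eval_comp_of_eval d (hc n), h], fun n => ?_⟩
  rw [queries_comp_of_eval d (hc n), hd, Set.union_empty]
  exact hU n

theorem of_computable (X : ℕ → ℕ) (hf : Computable f) :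
    ComputableWithQueries X (fun _ => ∅) f := by
  obtain ⟨c, hc, hq⟩ := exists_eval_eq_of_partrec X (Partrec.nat_iff.1 hf)
  exact ⟨c, fun n => congrFun hc n, fun n => (hq n).subset⟩

theorem computable_comp (hf : Computable f) (hg : ComputableWithQueries X U g) :
    ComputableWithQueries X U fun n => f (g n) :=
  ((of_computable X hf).comp hg).mono fun _ => by rw [Set.union_empty]

theorem computable₂_comp {F : ℕ → ℕ → ℕ} (hF : Computable₂ F)
    (hf : ComputableWithQueries X U f) (hg : ComputableWithQueries X V g) :
    ComputableWithQueries X (fun n => U n ∪ V n) fun n => F (f n) (g n) := by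
  have hunpair : Computable fun p : ℕ => F p.unpair.1 p.unpair.2 :=
    hF.comp (Computable.fst.comp Computable.unpair) (Computable.snd.comp Computable.unpair)
  simpa only [Nat.unpair_pair] using (hf.pair hg).computable_comp hunpair

theorem prec {h : ℕ → ℕ} (hf : ComputableWithQueries X U f) (hg : ComputableWithQueries X V g)
    (hzero : ∀ a, h (Nat.pair a 0) = f a)
    (hsucc : ∀ a y, h (Nat.pair a (y + 1)) = g (Nat.pair a (Nat.pair y (h (Nat.pair a y))))) :
    ComputableWithQueries X (fun p => U p.unpair.1 ∪ ⋃ y < p.unpair.2,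
      V (Nat.pair p.unpair.1 (Nat.pair y (h (Nat.pair p.unpair.1 y))))) h := by
  obtain ⟨c, hc, hU⟩ := hf
  obtain ⟨d, hd, hV⟩ := hg
  have heval : ∀ a n, eval X (.prec c d) (Nat.pair a n) = Part.some (h (Nat.pair a n)) := by
    intro a n
    induction n with
    | zero => simp [eval, hc a, hzero]
    | succ n ih => rw [eval_prec_succ, ih, hsucc, ← hd]; exact Part.bind_some _ _
  refine ⟨.prec c d, fun p => by simpa using heval p.unpair.1 p.unpair.2, fun p => ?_⟩
  rintro q (hq | ⟨y, hy, i, hi, hq⟩)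
  · exact Or.inl (hU _ hq)
  · rw [heval, Part.mem_some_iff] at hi
    subst hi
    exact Or.inr (Set.mem_biUnion (x := y) hy (hV _ hq))

theorem encode_initSeg (hf : ComputableWithQueries X U f) :
    ComputableWithQueries X (fun n => ⋃ k < n, U k) fun n => Encodable.encode (initSeg f n) := by
  let snoc (l v : ℕ) : ℕ :=
    Encodable.encode (((Encodable.decode l : Option (List ℕ)).getD []) ++ [v])
  have hsnoc : Computable₂ snoc := (Primrec.encode.comp (Primrec.list_concat.comp
    (Primrec.option_getD.comp (Primrec.decode.comp Primrec.fst) (Primrec.const []))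
    Primrec.snd)).to_comp
  have hindex : Computable fun z : ℕ => z.unpair.2.unpair.1 :=
    (Primrec.fst.comp (Primrec.unpair.comp (Primrec.snd.comp Primrec.unpair))).to_comp
  have hvalue : Computable fun z : ℕ => z.unpair.2.unpair.2 :=
    (Primrec.snd.comp (Primrec.unpair.comp (Primrec.snd.comp Primrec.unpair))).to_comp
  have hstep := computable₂_comp hsnoc (of_computable X hvalue) (hf.comp (of_computable X hindex))
  have hrec := prec (h := fun p => Encodable.encode (initSeg f p.unpair.2))
    (of_computable X (Computable.const (Encodable.encode ([] : List ℕ)))) hstep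
    (fun a => by simp [initSeg]) (fun a y => by simp [snoc, initSeg_succ])
  have hinput : Computable (Nat.pair 0) :=
    (Primrec₂.natPair.comp (Primrec.const 0) Primrec.id).to_comp
  simpa using hrec.comp (of_computable X hinput)

theorem rfind (hf : ComputableWithQueries X U f) (hzero : ∀ n, f (Nat.pair n (g n)) = 0)
    (hne : ∀ n, ∀ k < g n, f (Nat.pair n k) ≠ 0) :
    ComputableWithQueries X (fun n => ⋃ k ≤ g n, U (Nat.pair n k)) g := by
  obtain ⟨c, hc, hU⟩ := hf
  refine ⟨.rfind c, fun n => ?_, fun n => ?_⟩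
  · refine Part.eq_some_iff.2 (Nat.mem_rfind.2 ⟨?_, fun {k} hk => ?_⟩)
    · simp [hc _, hzero]
    · simpa [hc _] using hne n k hk
  · rintro q ⟨k, hk, hq⟩
    have hkg : k ≤ g n := by
      by_contra! hlt
      obtain ⟨m, hm, hm0⟩ := hk (g n) hlt
      rw [hc, hzero, Part.mem_some_iff] at hm
      exact hm0 hm
    exact Set.mem_biUnion (x := k) hkg (hU _ hq)

theorem turingReducible (hf : ComputableWithQueries X U f) :
    TuringReducible (f : ℕ →. ℕ) (X : ℕ →. ℕ) := by
  obtain ⟨c, hc, -⟩ := hf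
  exact (exists_code_iff X f).1 ⟨c, funext hc⟩

theorem wttReducible (hf : ComputableWithQueries X Set.Iic f) : WttReducible f X := by
  obtain ⟨c, hc, hU⟩ := hf
  exact ⟨c, hc, id, Computable.id,
    fun n => use_le fun m hm => (hU m).trans (Set.Iic_subset_Iio.2 hm)⟩

end ComputableWithQueries

/-! ### The first two jumps -/

namespace OracleCode

theorem encode_surjective : Function.Surjective encode := by
  intro n
  induction n using Nat.strong_induction_on with
  | _ n ih =>
    rcases lt_or_ge n 5 with hn | hn
    · interval_cases n
      exacts [⟨zero, rfl⟩, ⟨succ, rfl⟩, ⟨left, rfl⟩, ⟨right, rfl⟩, ⟨oracle, rfl⟩]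
    · have hm : (n - 5) / 4 < n := by omega
      obtain ⟨c, hc⟩ := ih _ (((n - 5) / 4).unpair_left_le.trans_lt hm)
      obtain ⟨d, hd⟩ := ih _ (((n - 5) / 4).unpair_right_le.trans_lt hm)
      obtain ⟨e, he⟩ := ih _ hm
      obtain h | h | h | h : (n - 5) % 4 = 0 ∨ (n - 5) % 4 = 1 ∨ (n - 5) % 4 = 2 ∨
        (n - 5) % 4 = 3 := by omega
      · exact ⟨pair c d, by rw [encode, hc, hd, Nat.pair_unpair]; omega⟩
      · exact ⟨comp c d, by rw [encode, hc, hd, Nat.pair_unpair]; omega⟩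
      · exact ⟨prec c d, by rw [encode, hc, hd, Nat.pair_unpair]; omega⟩
      · exact ⟨rfind e, by rw [encode, he]; omega⟩

noncomputable instance : Denumerable OracleCode :=
  Denumerable.mk' (Equiv.ofBijective encode ⟨encode_injective, encode_surjective⟩)

theorem ofNat_encode (c : OracleCode) : Denumerable.ofNat OracleCode (encode c) = c :=
  Denumerable.ofNat_encode c

theorem primrec_encode : Primrec encode := Primrec.encode

theorem primrec₂_comp : Primrec₂ comp :=
  Primrec.encode_iff.1 <| Primrec.nat_add.comp (Primrec.nat_mul.comp (Primrec.const 4)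
    (Primrec₂.natPair.comp (primrec_encode.comp Primrec.fst) (primrec_encode.comp Primrec.snd)))
    (Primrec.const 6)

/-- The value of a recursion over programs at the Gödel number `l.length`, given the list `l` of
all values at smaller Gödel numbers. -/
def recursionStep {σ : Type*} (atoms : List σ) (z : σ) (P C R : σ → σ → σ) (M : σ → σ)
    (l : List σ) : σ :=
  let m := (l.length - 5) / 4
  if l.length < 5 then atoms.getD l.length z
  else if (l.length - 5) % 4 = 0 then P (l.getD m.unpair.1 z) (l.getD m.unpair.2 z)
  else if (l.length - 5) % 4 = 1 then C (l.getD m.unpair.1 z) (l.getD m.unpair.2 z)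
  else if (l.length - 5) % 4 = 2 then R (l.getD m.unpair.1 z) (l.getD m.unpair.2 z)
  else M (l.getD m z)

section Recursion

variable {σ : Type*} {F : OracleCode → σ} {P C R : σ → σ → σ} {M : σ → σ}

theorem recursionStep_initSeg (atoms : List σ) (z : σ) (f : ℕ → σ) (m : ℕ) {r : ℕ}
    (hr : r < 4) :
    recursionStep atoms z P C R M (initSeg f (4 * m + r + 5)) =
      if r = 0 then P (f m.unpair.1) (f m.unpair.2)
      else if r = 1 then C (f m.unpair.1) (f m.unpair.2)
      else if r = 2 then R (f m.unpair.1) (f m.unpair.2)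
      else M (f m) := by
  have hget : ∀ k ≤ m, (initSeg f (4 * m + r + 5)).getD k z = f k := fun k hk => by
    rw [List.getD_eq_getElem?_getD, getElem?_initSeg_of_lt _ (by omega), Option.getD_some]
  have hdiv : (4 * m + r + 5 - 5) / 4 = m := by omega
  have hmod : (4 * m + r + 5 - 5) % 4 = r := by omega
  simp only [recursionStep, length_initSeg, hdiv, hmod, hget _ m.unpair_left_le,
    hget _ m.unpair_right_le, hget _ le_rfl]
  rw [if_neg (by omega)]

theorem recursionStep_eq (hP : ∀ c d, F (pair c d) = P (F c) (F d))
    (hC : ∀ c d, F (comp c d) = C (F c) (F d)) (hR : ∀ c d, F (prec c d) = R (F c) (F d))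
    (hM : ∀ c, F (rfind c) = M (F c)) (c : OracleCode) :
    recursionStep [F zero, F succ, F left, F right, F oracle] (F zero) P C R M
      (initSeg (fun n => F (Denumerable.ofNat OracleCode n)) (encode c)) = F c := by
  have hstep := recursionStep_initSeg [F zero, F succ, F left, F right, F oracle] (F zero)
    (P := P) (C := C) (R := R) (M := M) (fun n => F (Denumerable.ofNat OracleCode n))
  cases c with
  | zero | succ | left | right | oracle => simp [recursionStep, length_initSeg, encode]
  | pair c d =>
    exact (hstep (Nat.pair (encode c) (encode d)) (r := 0) (by omega)).trans
      (by simp [ofNat_encode, hP])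
  | comp c d =>
    exact (hstep (Nat.pair (encode c) (encode d)) (r := 1) (by omega)).trans
      (by simp [ofNat_encode, hC])
  | prec c d =>
    exact (hstep (Nat.pair (encode c) (encode d)) (r := 2) (by omega)).trans
      (by simp [ofNat_encode, hR])
  | rfind c => exact (hstep (encode c) (r := 3) (by omega)).trans (by simp [ofNat_encode, hM])

variable [Primcodable σ]

theorem primrec_recursionStep (atoms : List σ) (z : σ) (hP : Primrec₂ P) (hC : Primrec₂ C)
    (hR : Primrec₂ R) (hM : Primrec M) : Primrec (recursionStep atoms z P C R M) := by
  have hlen : Primrec fun l : List σ => l.length - 5 :=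
    Primrec.nat_sub.comp Primrec.list_length (Primrec.const 5)
  have hdiv := Primrec.nat_div.comp hlen (Primrec.const 4)
  have hmod := Primrec.nat_mod.comp hlen (Primrec.const 4)
  have hget := Primrec.list_getD z
  have hfst := hget.comp Primrec.id (Primrec.fst.comp (Primrec.unpair.comp hdiv))
  have hsnd := hget.comp Primrec.id (Primrec.snd.comp (Primrec.unpair.comp hdiv))
  exact Primrec.ite (Primrec.nat_lt.comp Primrec.list_length (Primrec.const 5))
    (hget.comp (Primrec.const atoms) Primrec.list_length)
    (Primrec.ite (Primrec.eq.comp hmod (Primrec.const 0)) (hP.comp hfst hsnd)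
      (Primrec.ite (Primrec.eq.comp hmod (Primrec.const 1)) (hC.comp hfst hsnd)
        (Primrec.ite (Primrec.eq.comp hmod (Primrec.const 2)) (hR.comp hfst hsnd)
          (hM.comp (hget.comp Primrec.id hdiv)))))

theorem primrec_of_recursion (primrec_P : Primrec₂ P) (primrec_C : Primrec₂ C)
    (primrec_R : Primrec₂ R) (primrec_M : Primrec M) (hP : ∀ c d, F (pair c d) = P (F c) (F d))
    (hC : ∀ c d, F (comp c d) = C (F c) (F d)) (hR : ∀ c d, F (prec c d) = R (F c) (F d))
    (hM : ∀ c, F (rfind c) = M (F c)) : Primrec F := by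
  have hstep := primrec_recursionStep [F zero, F succ, F left, F right, F oracle] (F zero)
    primrec_P primrec_C primrec_R primrec_M
  refine Primrec.ofNat_iff.2 ((Primrec.nat_strong_rec
    (fun (_ : Unit) n => F (Denumerable.ofNat OracleCode n))
    (Primrec.option_some.comp (hstep.comp Primrec.snd)).to₂ fun _ n => ?_).comp
      (Primrec.const ()) Primrec.id)
  obtain ⟨c, rfl⟩ := encode_surjective n
  rw [ofNat_encode]
  exact congrArg some (recursionStep_eq hP hC hR hM c)

end Recursion

/-- The oracle-free program obtained by answering all oracle queries with `0`. -/
def erase : OracleCode → Code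
  | zero => .zero
  | succ => .succ
  | left => .left
  | right => .right
  | oracle => .zero
  | pair c d => .pair (erase c) (erase d)
  | comp c d => .comp (erase c) (erase d)
  | prec c d => .prec (erase c) (erase d)
  | rfind c => .comp (.rfind' (erase c)) (.pair .id .zero)

theorem eval_erase (c : OracleCode) : (erase c).eval = eval (fun _ => 0) c := by
  induction c with
  | zero | succ | left | right | oracle => rfl
  | pair c d ihc ihd | comp c d ihc ihd | prec c d ihc ihd =>
    simp only [erase, Code.eval, eval, ihc, ihd]; rfl
  | rfind c ih =>
    funext a
    have hstart : (Code.pair .id .zero).eval a = Part.some (Nat.pair a 0) := by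
      simp only [Code.eval, Code.eval_id]
      simp [Seq.seq, pure, PFun.pure]
    simp only [erase, Code.eval, eval] at hstart ⊢
    rw [hstart]
    simp [Nat.unpaired, ih, Part.map_id']

theorem primrec_erase : Primrec erase :=
  primrec_of_recursion Code.primrec₂_pair Code.primrec₂_comp Code.primrec₂_prec
    (Code.primrec₂_comp.comp Code.primrec_rfind' (Primrec.const (Code.pair .id .zero)))
    (fun _ _ => rfl) (fun _ _ => rfl) (fun _ _ => rfl) fun _ => rfl

/-- The program with constant output `k`. -/
def const : ℕ → OracleCode
  | 0 => zero
  | k + 1 => comp succ (const k)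

theorem eval_const (X : ℕ → ℕ) (k n : ℕ) : eval X (const k) n = Part.some k := by
  induction k with
  | zero => rfl
  | succ k ih => rw [const, eval_comp_of_eval _ ih]; rfl

theorem primrec_const : Primrec const := by
  refine (Primrec.nat_rec₁ zero (primrec₂_comp.comp (Primrec.const succ)
    Primrec.snd).to₂).of_eq fun k => ?_
  induction k with
  | zero => rfl
  | succ k ih => exact congrArg (comp succ) ih

end OracleCode

section Jump

open OracleCode

variable {A : Set ℕ}

theorem encode_mem_jump_iff {c : OracleCode} :
    encode c ∈ jump A ↔ (eval (charFn A) c (encode c)).Dom := by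
  refine ⟨?_, fun h => ⟨c, rfl, h⟩⟩
  rintro ⟨d, hd, h⟩
  rwa [encode_injective hd] at h

theorem manyOneReducible_jump_of_turingReducible {f : ℕ →. ℕ}
    (hf : TuringReducible f (charFn A : ℕ →. ℕ)) : (fun n => (f n).Dom) ≤₀ (· ∈ jump A) := by
  obtain ⟨c, rfl⟩ := (exists_code_iff _ _).2 hf
  refine ⟨fun k => encode (comp c (const k)), (primrec_encode.comp
    (primrec₂_comp.comp (Primrec.const c) primrec_const)).to_comp, fun k => ?_⟩
  exact (encode_mem_jump_iff.trans (by rw [eval_comp_of_eval _ (eval_const _ _ _)])).symm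

theorem rePred_mem_jump_empty : REPred (· ∈ jump ∅) := by
  have hzero : charFn ∅ = fun _ => 0 := by funext; simp [charFn]
  refine (Partrec.dom_re (Code.eval_part.comp
    (primrec_erase.comp (Primrec.ofNat OracleCode)).to_comp Computable.id)).of_eq fun n => ?_
  obtain ⟨c, rfl⟩ := encode_surjective n
  rw [encode_mem_jump_iff, hzero, ← eval_erase, ofNat_encode, id_eq]

theorem exists_primrec₂_eventually_eq_charFn (hA : REPred (· ∈ A)) :
    ∃ K : ℕ → ℕ → ℕ, Primrec₂ K ∧ ∀ n, ∀ᶠ s in atTop, K s n = charFn A n := by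
  classical
  obtain ⟨c, hc⟩ := Code.exists_code.1 (Partrec.nat_iff.1 (hA.map (Computable.const 0).to₂))
  have hdom : ∀ n, n ∈ A ↔ ∃ s, (c.evaln s n).isSome := fun n => by
    have hmem : n ∈ A ↔ (c.eval n).Dom := by
      rw [hc]
      exact (exists_prop.trans (and_iff_left trivial)).symm
    simp only [hmem, Part.dom_iff_mem, Code.evaln_complete, Option.isSome_iff_exists]
    exact exists_comm
  refine ⟨fun s n => if (c.evaln s n).isSome then 1 else 0, ?_, fun n => ?_⟩
  · refine Primrec.ite (Primrec.eq.comp (Primrec.option_isSome.comp (Code.primrec_evaln.comp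
      (Primrec.pair (Primrec.pair Primrec.fst (Primrec.const c)) Primrec.snd)))
      (Primrec.const true)) (Primrec.const 1) (Primrec.const 0)
  by_cases hn : n ∈ A
  · obtain ⟨k, hk⟩ := (hdom n).1 hn
    filter_upwards [eventually_ge_atTop k] with s hs
    have hsome : (c.evaln s n).isSome := by
      obtain ⟨x, hx⟩ := Option.isSome_iff_exists.1 hk
      exact Option.isSome_iff_exists.2 ⟨x, Code.evaln_mono hs hx⟩
    simp [charFn, hn, hsome]
  · have hnone : ∀ s, ¬ (c.evaln s n).isSome := fun s hs => hn ((hdom n).2 ⟨s, hs⟩)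
    exact Eventually.of_forall fun s => by simp [charFn, hn, hnone]

/-- The indices, in Mathlib's numbering of oracle-free programs, of the total recursive
functions. -/
def totalCodes : Set ℕ := {e | ∀ n, ((Denumerable.ofNat Code e).eval n).Dom}

theorem notMem_totalCodes_manyOneReducible_jump_jump :
    (· ∉ totalCodes) ≤₀ (· ∈ jump (jump ∅)) := by
  have huniv : Partrec fun m : ℕ => (Denumerable.ofNat Code m.unpair.1).eval m.unpair.2 :=
    Code.eval_part.comp ((Primrec.ofNat Code).comp (Primrec.fst.comp Primrec.unpair)).to_comp
      (Primrec.snd.comp Primrec.unpair).to_comp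
  obtain ⟨k, hk, hhalt⟩ :=
    manyOneReducible_jump_of_turingReducible (A := ∅) (Partrec.turingReducible huniv)
  obtain ⟨c, hc, -⟩ := (ComputableWithQueries.oracle (charFn (jump ∅))).comp
    (ComputableWithQueries.of_computable _ hk)
  obtain ⟨r, hr, hdom⟩ := manyOneReducible_jump_of_turingReducible
    ((exists_code_iff (charFn (jump ∅)) _).1 ⟨rfind c, rfl⟩)
  refine ⟨r, hr, fun e => Iff.trans ?_ (hdom e)⟩
  have hzero : ∀ n, charFn (jump ∅) (k (Nat.pair e n)) = 0 ↔
      ¬ ((Denumerable.ofNat Code e).eval n).Dom := fun n => by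
    have hn := hhalt (Nat.pair e n)
    simp only [Nat.unpair_pair] at hn
    simp [charFn, hn]
  refine Iff.trans ?_ Nat.rfind_dom.symm
  simp only [totalCodes, Set.mem_ofPred_eq, not_forall, ← hzero]
  exact exists_congr fun n => by simp [hc _]

theorem turingReducible_charFn_of_notMem_manyOneReducible {C : Set ℕ}
    (h : (· ∉ A) ≤₀ (· ∈ C)) : TuringReducible (charFn A : ℕ →. ℕ) (charFn C : ℕ →. ℕ) := by
  obtain ⟨r, hr, hrC⟩ := h
  have hflip : Computable fun v => 1 - v :=
    (Primrec.nat_sub.comp (Primrec.const 1) Primrec.id).to_comp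
  have hcomp := ((ComputableWithQueries.oracle (charFn C)).comp
    (.of_computable _ hr)).computable_comp hflip
  have heq : charFn A = fun n => 1 - charFn C (r n) := by
    funext n
    have hn : n ∉ A ↔ r n ∈ C := hrC n
    by_cases h : n ∈ A <;> simp [charFn, ← hn, h]
  rw [heq]
  exact hcomp.turingReducible

end Jump

/-- The join of two functions: `f` on the even and `g` on the odd numbers. -/
def joinFn (f g : ℕ → ℕ) (n : ℕ) : ℕ := if n % 2 = 0 then f (n / 2) else g (n / 2)

theorem turingReducible_joinFn_left (f g : ℕ → ℕ) :
    TuringReducible (f : ℕ →. ℕ) (joinFn f g : ℕ →. ℕ) := by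
  have hdouble : Computable fun n => 2 * n :=
    (Primrec.nat_mul.comp (Primrec.const 2) Primrec.id).to_comp
  have h := (ComputableWithQueries.oracle (joinFn f g)).comp (.of_computable _ hdouble)
  simpa [joinFn] using h.turingReducible

theorem turingReducible_joinFn_right (f g : ℕ → ℕ) :
    TuringReducible (g : ℕ →. ℕ) (joinFn f g : ℕ →. ℕ) := by
  have hodd : Computable fun n => 2 * n + 1 :=
    (Primrec.succ.comp (Primrec.nat_mul.comp (Primrec.const 2) Primrec.id)).to_comp
  have hdiv : ∀ n, (2 * n + 1) / 2 = n := fun n => by omega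
  have h := (ComputableWithQueries.oracle (joinFn f g)).comp (.of_computable _ hodd)
  simpa [joinFn, Nat.add_mod, hdiv] using h.turingReducible

theorem turingReducible_joinFn_of_isLUB {A B C : Set ℕ} {j : TuringDegree}
    (hj : IsLUB {degT A, degT B} j) (hC : degT C ≤ j) :
    TuringReducible (charFn C : ℕ →. ℕ) (joinFn (charFn A) (charFn B) : ℕ →. ℕ) := by
  have hub : toAntisymmetrization TuringReducible (joinFn (charFn A) (charFn B) : ℕ →. ℕ) ∈
      upperBounds {degT A, degT B} := by
    rintro _ (rfl | rfl)
    · exact turingReducible_joinFn_left _ _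
    · exact turingReducible_joinFn_right _ _
  exact hC.trans (hj.2 hub)

/-! ### Truncated computations -/

theorem findIdx_range_eq_iff {t : ℕ → Bool} {n i : ℕ} : (List.range n).findIdx t = i ↔
    i ≤ n ∧ (i < n → t i) ∧ ∀ k < i, ¬ t k := by
  constructor
  · rintro rfl
    refine ⟨List.findIdx_le_length.trans_eq List.length_range, fun h => ?_, fun k hk => ?_⟩
    · have hlt : (List.range n).findIdx t < (List.range n).length := by simpa using h
      exact (congrArg t (List.getElem_range hlt)).symm.trans List.findIdx_getElem
    · simpa using List.not_of_lt_findIdx hk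
  · rintro ⟨hin, hi, hk⟩
    rcases hin.lt_or_eq with hlt | rfl
    · exact (List.findIdx_eq (by simpa using hlt)).2 (by simpa [hi hlt] using hk)
    · exact (List.findIdx_eq_length.2 (by simpa using hk)).trans List.length_range

namespace OracleCode

/-- Evaluation with a partial oracle `p`, where the unbounded searches are cut off after `s`
steps; queries outside the domain of `p` make the computation fail. -/
def truncEval (p : ℕ → Option ℕ) (s : ℕ) : OracleCode → ℕ → Option ℕ
  | zero, _ => some 0
  | succ, n => some (n + 1)
  | left, n => some n.unpair.1
  | right, n => some n.unpair.2
  | oracle, n => p n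
  | pair c d, n => (truncEval p s c n).bind fun x => (truncEval p s d n).map fun y => Nat.pair x y
  | comp c d, n => (truncEval p s d n).bind fun m => truncEval p s c m
  | prec c d, m => Nat.rec (truncEval p s c m.unpair.1) (fun y o =>
      o.bind fun i => truncEval p s d (Nat.pair m.unpair.1 (Nat.pair y i))) m.unpair.2
  | rfind c, a =>
      -- a failing test must stop the search as well, hence the default value `0`
      let i := (List.range s).findIdx fun k => (truncEval p s c (Nat.pair a k)).getD 0 == 0
      if truncEval p s c (Nat.pair a i) = some 0 then some i else none

theorem truncEval_prec_succ (p : ℕ → Option ℕ) (s : ℕ) (c d : OracleCode) (a y : ℕ) :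
    truncEval p s (prec c d) (Nat.pair a (y + 1)) =
      (truncEval p s (prec c d) (Nat.pair a y)).bind fun i =>
        truncEval p s d (Nat.pair a (Nat.pair y i)) := by
  simp [truncEval]

theorem truncEval_rfind_eq_some_iff {p : ℕ → Option ℕ} {s : ℕ} {c : OracleCode} {a i : ℕ} :
    truncEval p s (rfind c) a = some i ↔ i ≤ s ∧ truncEval p s c (Nat.pair a i) = some 0 ∧
      ∀ k < i, ∃ m, m ≠ 0 ∧ truncEval p s c (Nat.pair a k) = some m := by
  have hne : ∀ k, ¬ ((truncEval p s c (Nat.pair a k)).getD 0 == 0) ↔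
      ∃ m, m ≠ 0 ∧ truncEval p s c (Nat.pair a k) = some m := fun k => by
    cases truncEval p s c (Nat.pair a k) <;> simp
  set test : ℕ → Bool := fun k => (truncEval p s c (Nat.pair a k)).getD 0 == 0 with htest
  have hfind : truncEval p s (rfind c) a = some i ↔
      (List.range s).findIdx test = i ∧ truncEval p s c (Nat.pair a i) = some 0 := by
    simp only [truncEval, Option.ite_none_right_eq_some, Option.some.injEq, ← htest]
    exact ⟨fun h => ⟨h.2, h.2 ▸ h.1⟩, fun h => ⟨h.1.symm ▸ h.2, h.1⟩⟩
  rw [hfind, findIdx_range_eq_iff, and_assoc, and_assoc]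
  refine and_congr_right fun _ => ⟨fun h => ⟨h.2.2, fun k hk => (hne k).1 (h.2.1 k hk)⟩,
    fun h => ⟨fun _ => by simp [htest, h.1], fun k hk => (hne k).2 (h.2 k hk), h.1⟩⟩

theorem primrec_truncEval {α : Type*} [Primcodable α] {p : α → ℕ → Option ℕ} {s : α → ℕ}
    (hp : Primrec₂ p) (hs : Primrec s) (c : OracleCode) :
    Primrec₂ fun a n => truncEval (p a) (s a) c n := by
  induction c with
  | zero => exact (Primrec.const (some 0)).to₂
  | succ => exact (Primrec.option_some.comp (Primrec.succ.comp Primrec.snd)).to₂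
  | left =>
    exact (Primrec.option_some.comp (Primrec.fst.comp (Primrec.unpair.comp Primrec.snd))).to₂
  | right =>
    exact (Primrec.option_some.comp (Primrec.snd.comp (Primrec.unpair.comp Primrec.snd))).to₂
  | oracle => exact hp
  | pair c d ihc ihd =>
    refine Primrec.option_bind ihc (Primrec.option_map (g := fun x : (α × ℕ) × ℕ => Nat.pair x.2)
      (ihd.comp (Primrec.fst.comp Primrec.fst) (Primrec.snd.comp Primrec.fst)) ?_).to₂
    exact Primrec₂.natPair.comp (Primrec.snd.comp Primrec.fst) Primrec.snd
  | comp c d ihc ihd =>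
    exact Primrec.option_bind ihd (ihc.comp₂ (Primrec.fst.comp₂ Primrec₂.left) Primrec₂.right)
  | prec c d ihc ihd =>
    have hu : Primrec fun x : α × ℕ => x.2.unpair := Primrec.unpair.comp Primrec.snd
    refine Primrec.nat_rec' (h := fun (x : α × ℕ) (z : ℕ × Option ℕ) => z.2.bind fun i =>
        truncEval (p x.1) (s x.1) d (Nat.pair x.2.unpair.1 (Nat.pair z.1 i)))
      (Primrec.snd.comp hu) (ihc.comp Primrec.fst (Primrec.fst.comp hu)) ?_
    refine Primrec.option_bind (Primrec.snd.comp Primrec.snd) ?_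
    exact ihd.comp (Primrec.fst.comp (Primrec.fst.comp Primrec.fst)) (Primrec₂.natPair.comp
      (Primrec.fst.comp (hu.comp (Primrec.fst.comp Primrec.fst)))
      (Primrec₂.natPair.comp (Primrec.fst.comp (Primrec.snd.comp Primrec.fst)) Primrec.snd))
  | rfind c ih =>
    have htest : Primrec₂ fun (x : α × ℕ) k =>
        (truncEval (p x.1) (s x.1) c (Nat.pair x.2 k)).getD 0 == 0 :=
      Primrec.beq.comp (Primrec.option_getD.comp (ih.comp (Primrec.fst.comp Primrec.fst)
        (Primrec₂.natPair.comp (Primrec.snd.comp Primrec.fst) Primrec.snd)) (Primrec.const 0))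
        (Primrec.const 0)
    have hindex := Primrec.list_findIdx (Primrec.list_range.comp (hs.comp Primrec.fst)) htest
    exact Primrec.ite (Primrec.eq.comp (ih.comp Primrec.fst
      (Primrec₂.natPair.comp Primrec.snd hindex)) (Primrec.const (some 0)))
      (Primrec.option_some.comp hindex) (Primrec.const none)

theorem truncEval_mono {p p' : ℕ → Option ℕ} (hp : ∀ q v, p q = some v → p' q = some v) (s : ℕ)
    (c : OracleCode) : ∀ n v, truncEval p s c n = some v → truncEval p' s c n = some v := by
  induction c with
  | zero | succ | left | right => exact fun n v h => h
  | oracle => exact hp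
  | pair c d ihc ihd =>
    intro n v h
    simp only [truncEval, Option.bind_eq_some_iff, Option.map_eq_some_iff] at h ⊢
    obtain ⟨x, hx, y, hy, rfl⟩ := h
    exact ⟨x, ihc n x hx, y, ihd n y hy, rfl⟩
  | comp c d ihc ihd =>
    intro n v h
    simp only [truncEval, Option.bind_eq_some_iff] at h ⊢
    obtain ⟨x, hx, hv⟩ := h
    exact ⟨x, ihd n x hx, ihc x v hv⟩
  | prec c d ihc ihd =>
    intro m v h
    obtain ⟨a, n, rfl⟩ : ∃ a n, Nat.pair a n = m := ⟨_, _, Nat.pair_unpair m⟩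
    induction n generalizing v with
    | zero => simpa [truncEval] using ihc a v (by simpa [truncEval] using h)
    | succ n ih =>
      simp only [truncEval_prec_succ, Option.bind_eq_some_iff] at h ⊢
      obtain ⟨x, hx, hv⟩ := h
      exact ⟨x, ih x hx, ihd _ v hv⟩
  | rfind c ih =>
    intro a i h
    obtain ⟨hi, hzero, hne⟩ := truncEval_rfind_eq_some_iff.1 h
    refine truncEval_rfind_eq_some_iff.2 ⟨hi, ih _ 0 hzero, fun k hk => ?_⟩
    obtain ⟨m, hm, hkm⟩ := hne k hk
    exact ⟨m, hm, ih _ m hkm⟩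

section Convergence

variable {ι : Type*} {l : Filter ι} {p : ι → ℕ → Option ℕ} {b : ι → ℕ} {X : ℕ → ℕ}

theorem eventually_truncEval_rfind_eq_some (hb : Tendsto b l atTop) {c : OracleCode}
    (hc : ∀ n v, v ∈ eval X c n → ∀ᶠ i in l, truncEval (p i) (b i) c n = some v) :
    ∀ n v, v ∈ eval X (rfind c) n → ∀ᶠ i in l, truncEval (p i) (b i) (rfind c) n = some v := by
  intro n v hv
  obtain ⟨hv, hlt⟩ := Nat.mem_rfind.1 hv
  obtain ⟨x, hx, hx0⟩ := (Part.mem_map_iff _).1 hv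
  obtain rfl : x = 0 := of_decide_eq_true hx0
  have hbelow : ∀ᶠ i in l, ∀ k < v, ∃ m, m ≠ 0 ∧
      truncEval (p i) (b i) c (Nat.pair n k) = some m := by
    refine (Set.finite_Iio v).eventually_all.2 fun k hk => ?_
    obtain ⟨y, hy, hy0⟩ := (Part.mem_map_iff _).1 (hlt hk)
    filter_upwards [hc _ y hy] with i hi
    exact ⟨y, of_decide_eq_false hy0, hi⟩
  filter_upwards [hbelow, hc _ 0 hx, hb.eventually_ge_atTop v] with i hi hiv hbi
  exact truncEval_rfind_eq_some_iff.2 ⟨hbi, hiv, hi⟩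

theorem eventually_truncEval_eq_some (hb : Tendsto b l atTop)
    (hp : ∀ q, ∀ᶠ i in l, p i q = some (X q)) (c : OracleCode) :
    ∀ n v, v ∈ eval X c n → ∀ᶠ i in l, truncEval (p i) (b i) c n = some v := by
  induction c with
  | zero | succ | left | right =>
    intro n v hv
    simp only [eval, Part.mem_some_iff] at hv
    simp [truncEval, hv]
  | oracle =>
    intro n v hv
    simp only [eval, Part.mem_some_iff] at hv
    simpa [truncEval, hv] using hp n
  | pair c d ihc ihd =>
    intro n v hv
    simp only [eval, Seq.seq, Part.map_eq_map, Part.mem_bind_iff, Part.mem_map_iff] at hv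
    obtain ⟨_, ⟨x, hx, rfl⟩, y, hy, rfl⟩ := hv
    filter_upwards [ihc n x hx, ihd n y hy] with i hci hdi
    simp [truncEval, hci, hdi]
  | comp c d ihc ihd =>
    intro n v hv
    obtain ⟨x, hx, hv⟩ := Part.mem_bind_iff.1 hv
    filter_upwards [ihd n x hx, ihc x v hv] with i hdi hci
    simp [truncEval, hdi, hci]
  | prec c d ihc ihd =>
    intro m v hv
    obtain ⟨a, n, rfl⟩ : ∃ a n, Nat.pair a n = m := ⟨_, _, Nat.pair_unpair m⟩
    induction n generalizing v with
    | zero => simpa [truncEval] using ihc a v (by simpa [eval] using hv)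
    | succ n ih =>
      rw [eval_prec_succ] at hv
      obtain ⟨x, hx, hv⟩ := Part.mem_bind_iff.1 hv
      filter_upwards [ih x hx, ihd _ v hv] with i hxi hvi
      rw [truncEval_prec_succ, hxi, Option.bind_some, hvi]
  | rfind c ih => exact eventually_truncEval_rfind_eq_some hb ih

theorem eventually_eq_of_truncEval_eq_some (hb : Tendsto b l atTop)
    (hp : ∀ q, ∀ᶠ i in l, ∀ w, p i q = some w → w = X q) {c : OracleCode} {n v : ℕ}
    (hv : v ∈ eval X c n) : ∀ᶠ i in l, ∀ w, truncEval (p i) (b i) c n = some w → w = v := by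
  -- filling the gaps of `p i` by the true oracle preserves the results already obtained
  have hfill : ∀ q, ∀ᶠ i in l, (p i q).or (some (X q)) = some (X q) := fun q => by
    filter_upwards [hp q] with i hi
    cases hpi : p i q with
    | none => rfl
    | some w => rw [hi w hpi, Option.some_or]
  filter_upwards [eventually_truncEval_eq_some hb hfill c n v hv] with i hi w hw
  have hw' := truncEval_mono (p' := fun q => (p i q).or (some (X q)))
    (fun q u hu => by simp [hu]) (b i) c n w hw
  exact Option.some_injective _ (hw'.symm.trans hi)

end Convergence

end OracleCode

/-! ### A dominant function -/

theorem primrecRel_forall_lt {α : Type*} [Primcodable α] {R : ℕ → α → Prop} (hR : PrimrecRel R) :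
    PrimrecRel fun n a => ∀ k < n, R k a :=
  (hR.forall_mem_list.comp (Primrec.list_range.comp Primrec.fst) Primrec.snd).of_eq (by simp)

open OracleCode ComputableWithQueries

/-- The stage `s` approximation to `joinFn X Y`, where `l` is the known initial segment of `X` and
`K s` is the stage `s` approximation to `Y`. -/
def joinApprox (K : ℕ → ℕ → ℕ) (l : List ℕ) (s q : ℕ) : Option ℕ :=
  if q % 2 = 0 then l[q / 2]? else some (K s (q / 2))

/-- At stage `s`, either `Γ`, run on the stage `s` approximation to the join, does not claim that
the program with index `e` is total, or this program has been seen to halt on input `l.length` with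
output at most `s`. Here `Γ` is meant to compute `charFn totalCodes`. -/
def Settled (Γ : OracleCode) (K : ℕ → ℕ → ℕ) (l : List ℕ) (s e : ℕ) : Prop :=
  truncEval (joinApprox K l s) s Γ e = some 1 →
    ∃ x ∈ (Denumerable.ofNat Code e).evaln s l.length, x ≤ s

/-- At stage `s`, each proper initial segment of `l`, of length `i` say, has all the indices
`e < i` settled. The least such `s` is the dominant function of the proof, and the quantification
over initial segments is there to make it monotone. -/
def GoodStage (Γ : OracleCode) (K : ℕ → ℕ → ℕ) (l : List ℕ) (s : ℕ) : Prop :=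
  l.length ≤ s ∧ ∀ i < l.length, ∀ e < i, Settled Γ K (l.take i) s e

section Stages

variable {X Y : ℕ → ℕ} {K : ℕ → ℕ → ℕ} {Γ : OracleCode}

theorem primrec_joinApprox (hK : Primrec₂ K) :
    Primrec₂ fun (x : List ℕ × ℕ) q => joinApprox K x.1 x.2 q := by
  have hhalf : Primrec fun x : (List ℕ × ℕ) × ℕ => x.2 / 2 :=
    Primrec.nat_div.comp Primrec.snd (Primrec.const 2)
  exact Primrec.ite
    (Primrec.eq.comp (Primrec.nat_mod.comp Primrec.snd (Primrec.const 2)) (Primrec.const 0))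
    (Primrec.list_getElem?.comp (Primrec.fst.comp Primrec.fst) hhalf)
    (Primrec.option_some.comp (hK.comp (Primrec.snd.comp Primrec.fst) hhalf))

theorem primrecRel_settled (Γ : OracleCode) (hK : Primrec₂ K) :
    PrimrecRel fun (e : ℕ) (x : List ℕ × ℕ) => Settled Γ K x.1 x.2 e := by
  have hlist : Primrec fun x : ℕ × List ℕ × ℕ => x.2.1 := Primrec.fst.comp Primrec.snd
  have hstage : Primrec fun x : ℕ × List ℕ × ℕ => x.2.2 := Primrec.snd.comp Primrec.snd
  have hΓ : PrimrecPred fun x : ℕ × List ℕ × ℕ =>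
      truncEval (joinApprox K x.2.1 x.2.2) x.2.2 Γ x.1 = some 1 :=
    Primrec.eq.comp ((primrec_truncEval (primrec_joinApprox hK) Primrec.snd Γ).comp Primrec.snd
      Primrec.fst) (Primrec.const (some 1))
  have hhalt : PrimrecPred fun x : ℕ × List ℕ × ℕ =>
      ((Denumerable.ofNat Code x.1).evaln x.2.2 x.2.1.length).getD (x.2.2 + 1) ≤ x.2.2 :=
    Primrec.nat_le.comp (Primrec.option_getD.comp (Code.primrec_evaln.comp
      (Primrec.pair (Primrec.pair hstage ((Primrec.ofNat Code).comp Primrec.fst))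
        (Primrec.list_length.comp hlist))) (Primrec.succ.comp hstage)) hstage
  refine (hΓ.not.or hhalt).of_eq fun x => ?_
  obtain ⟨e, l, s⟩ := x
  refine Iff.trans ?_ imp_iff_not_or.symm
  cases (Denumerable.ofNat Code e).evaln s l.length <;> simp

theorem primrecRel_goodStage (Γ : OracleCode) (hK : Primrec₂ K) : PrimrecRel (GoodStage Γ K) := by
  have hsettled : PrimrecRel fun (i : ℕ) (x : List ℕ × ℕ) =>
      ∀ e < i, Settled Γ K (x.1.take i) x.2 e :=
    (primrecRel_forall_lt (primrecRel_settled Γ hK)).comp (f := fun x : ℕ × List ℕ × ℕ => x.1)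
      (g := fun x : ℕ × List ℕ × ℕ => (x.2.1.take x.1, x.2.2)) Primrec.fst (Primrec.pair
        (Primrec.list_take.comp Primrec.fst (Primrec.fst.comp Primrec.snd))
        (Primrec.snd.comp Primrec.snd))
  have hlength : Primrec fun x : List ℕ × ℕ => x.1.length := Primrec.list_length.comp Primrec.fst
  exact (Primrec.nat_le.comp hlength Primrec.snd).and
    ((primrecRel_forall_lt hsettled).comp hlength Primrec.id)

theorem GoodStage.take {l : List ℕ} {s : ℕ} (h : GoodStage Γ K l s) (n : ℕ) :
    GoodStage Γ K (l.take n) s := by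
  refine ⟨(List.length_take_le' n l).trans h.1, fun i hi e he => ?_⟩
  rw [List.length_take, lt_min_iff] at hi
  rw [List.take_take, min_eq_left hi.1.le]
  exact h.2 i hi.2 e he

theorem eventually_joinApprox_eq_some {ι : Type*} {l : Filter ι} {σ τ : ι → ℕ}
    (hK : ∀ n, ∀ᶠ s in atTop, K s n = Y n) (hσ : Tendsto σ l atTop) (hτ : Tendsto τ l atTop)
    (q : ℕ) : ∀ᶠ i in l, joinApprox K (initSeg X (τ i)) (σ i) q = some (joinFn X Y q) := by
  filter_upwards [hσ.eventually (hK (q / 2)), hτ.eventually_gt_atTop (q / 2)] with i hKi hqi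
  rw [joinApprox, joinFn, getElem?_initSeg_of_lt X hqi, hKi, apply_ite some]

theorem eventually_eq_of_joinApprox_eq_some (hK : ∀ n, ∀ᶠ s in atTop, K s n = Y n) (n q : ℕ) :
    ∀ᶠ s in atTop, ∀ w, joinApprox K (initSeg X n) s q = some w → w = joinFn X Y q := by
  filter_upwards [hK (q / 2)] with s hs w hw
  rw [joinApprox] at hw
  rw [joinFn]
  split_ifs at hw ⊢ with hq
  · rcases lt_or_ge (q / 2) n with h | h
    · simpa [getElem?_initSeg_of_lt X h, eq_comm] using hw
    · simp [getElem?_initSeg_of_le X h] at hw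
  · simpa [hs, eq_comm] using hw

theorem eventually_settled (hK : ∀ n, ∀ᶠ s in atTop, K s n = Y n)
    (hΓ : Γ.Computes (joinFn X Y) (charFn totalCodes)) (n e : ℕ) :
    ∀ᶠ s in atTop, Settled Γ K (initSeg X n) s e := by
  have hval : charFn totalCodes e ∈ Γ.eval (joinFn X Y) e := by rw [hΓ]; exact Part.mem_some _
  by_cases he : e ∈ totalCodes
  · obtain ⟨x, hx⟩ := Part.dom_iff_mem.1 (he n)
    obtain ⟨k, hk⟩ := Code.evaln_complete.1 hx
    filter_upwards [eventually_ge_atTop k, eventually_ge_atTop x] with s hks hxs _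
    exact ⟨x, by simpa only [length_initSeg] using Code.evaln_mono hks hk, hxs⟩
  · filter_upwards [eventually_eq_of_truncEval_eq_some tendsto_id
      (eventually_eq_of_joinApprox_eq_some hK n) hval] with s hs h
    simpa [charFn, he] using hs 1 h

theorem exists_goodStage (hK : ∀ n, ∀ᶠ s in atTop, K s n = Y n)
    (hΓ : Γ.Computes (joinFn X Y) (charFn totalCodes)) (n : ℕ) :
    ∃ s, GoodStage Γ K (initSeg X n) s := by
  have hall : ∀ᶠ s in atTop, ∀ i < n, ∀ e < i, Settled Γ K (initSeg X i) s e :=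
    (Set.finite_Iio n).eventually_all.2 fun i _ =>
      (Set.finite_Iio i).eventually_all.2 fun e _ => eventually_settled hK hΓ i e
  obtain ⟨s, hns, hs⟩ := ((eventually_ge_atTop n).and hall).exists
  rw [← length_initSeg X n] at hns
  refine ⟨s, hns, fun i hi => ?_⟩
  rw [length_initSeg] at hi
  rw [take_initSeg X hi.le]
  exact hs i hi

theorem isDominant_of_goodStage {f : ℕ → ℕ} (hK : ∀ n, ∀ᶠ s in atTop, K s n = Y n)
    (hΓ : Γ.Computes (joinFn X Y) (charFn totalCodes))
    (hf : ∀ n, GoodStage Γ K (initSeg X (n + 1)) (f n)) : IsDominant f := by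
  intro h hh
  obtain ⟨c, hc⟩ := Code.exists_code.1 (Partrec.nat_iff.1 hh)
  have hce : Denumerable.ofNat Code (Encodable.encode c) = c := Denumerable.ofNat_encode c
  have htotal : Encodable.encode c ∈ totalCodes := fun n => by rw [hce, hc]; trivial
  have hval : 1 ∈ Γ.eval (joinFn X Y) (Encodable.encode c) := by
    rw [hΓ]
    simp [charFn, htotal]
  have hlength : ∀ n, n < (initSeg X (n + 1)).length := fun n => by
    rw [length_initSeg]; exact n.lt_succ_self
  have htend : Tendsto f atTop atTop :=
    tendsto_atTop_mono (fun n => (hlength n).le.trans (hf n).1) tendsto_id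
  filter_upwards [eventually_truncEval_eq_some htend
    (eventually_joinApprox_eq_some hK htend tendsto_id) Γ _ _ hval,
    eventually_gt_atTop (Encodable.encode c)] with n hclaim hcn
  have hsettled := (hf n).2 n (hlength n) _ hcn
  rw [take_initSeg X n.le_succ] at hsettled
  obtain ⟨x, hx, hxf⟩ := hsettled hclaim
  rw [hce, length_initSeg] at hx
  have hxc : x ∈ c.eval n := Code.evaln_sound hx
  rw [hc] at hxc
  exact (Part.mem_some_iff.1 hxc).symm.trans_le hxf

theorem ComputableWithQueries.of_isLeast {R : List ℕ → ℕ → Prop} {f : ℕ → ℕ} (hR : PrimrecRel R)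
    (hf : ∀ n, IsLeast {s | R (initSeg X (n + 1)) s} (f n)) :
    ComputableWithQueries X Set.Iic f := by
  classical
  let φ : ℕ →. ℕ := fun m => Nat.rfind fun s =>
    Part.some (decide (R (((Encodable.decode m : Option (List ℕ))).getD []) s))
  have hφ : Nat.Partrec φ := Partrec.nat_iff.1 <| Partrec.rfind <| Computable.partrec <|
    Primrec.to_comp <| primrecPred_iff_primrec_decide.1 <| hR.comp (Primrec.option_getD.comp
      (Primrec.decode.comp Primrec.fst) (Primrec.const [])) Primrec.snd
  have hseg := (oracle X).encode_initSeg.comp (of_computable X Primrec.succ.to_comp)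
  refine (partrec_comp hφ hseg fun n => ?_).mono fun n q hq => ?_
  · refine Part.eq_some_iff.2 (Nat.mem_rfind.2 ⟨?_, fun {m} hm => ?_⟩)
    · simpa using (hf n).1
    · simpa using fun h => hm.not_ge ((hf n).2 h)
  · simpa using hq

theorem exists_monotone_isDominant (hprim : Primrec₂ K) (hK : ∀ n, ∀ᶠ s in atTop, K s n = Y n)
    (hΓ : Γ.Computes (joinFn X Y) (charFn totalCodes)) :
    ∃ f, Monotone f ∧ IsDominant f ∧ ComputableWithQueries X Set.Iic f := by
  have hex : ∀ n, ∃ s, IsLeast {s | GoodStage Γ K (initSeg X (n + 1)) s} s := fun n =>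
    ⟨_, isLeast_csInf (exists_goodStage hK hΓ (n + 1))⟩
  choose f hf using hex
  refine ⟨f, monotone_nat_of_le_succ fun n => (hf n).2 ?_,
    isDominant_of_goodStage hK hΓ fun n => (hf n).1, .of_isLeast (primrecRel_goodStage Γ hprim) hf⟩
  have hgood : GoodStage Γ K (initSeg X (n + 1 + 1)) (f (n + 1)) := (hf (n + 1)).1
  exact take_initSeg X (Nat.le_succ (n + 1)) ▸ hgood.take (n + 1)

end Stages

/-! ### Tiny use -/

theorem exists_monotone_isDominant_mod_two {B : Set ℕ} {f : ℕ → ℕ} (hmono : Monotone f)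
    (hdom : IsDominant f) (hf : ComputableWithQueries (charFn B) Set.Iic f) :
    ∃ g, Monotone g ∧ IsDominant g ∧ ComputableWithQueries (charFn B) Set.Iic g ∧
      ∀ n, g n % 2 = charFn B n := by
  have hbit : ∀ n, charFn B n < 2 := fun n => by rw [charFn]; split_ifs <;> norm_num
  refine ⟨fun n => 2 * (f n + n) + charFn B n, monotone_nat_of_le_succ fun n => ?_,
    fun h hh => ?_, ?_, fun n => ?_⟩
  · -- the summand `n` makes room for the change of the last bit
    have := hmono n.le_succ
    have := hbit n
    lia
  · filter_upwards [hdom h hh] with n hn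
    lia
  · have hsum : Computable₂ fun x n => 2 * (x + n) :=
      (Primrec.nat_mul.comp (Primrec.const 2) Primrec.nat_add).to_comp
    have hdouble := computable₂_comp hsum hf (of_computable (charFn B) Computable.id)
    refine (computable₂_comp Primrec.nat_add.to_comp hdouble (oracle (charFn B))).mono fun n => ?_
    simp
  · have := hbit n
    lia

/-- The region below the graph of `g`, as a set of coded pairs. The pair `(n, v)` can be decided
by finding the first argument at which `g` exceeds `v`. -/
def hypograph (g : ℕ → ℕ) : Set ℕ := {m | m.unpair.2 < g m.unpair.1}

theorem turingReducible_charFn_hypograph (g : ℕ → ℕ) :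
    TuringReducible (g : ℕ →. ℕ) (charFn (hypograph g) : ℕ →. ℕ) :=
  ((oracle (charFn (hypograph g))).rfind (g := g) (fun n => by simp [charFn, hypograph])
    fun n k hk => by simp [charFn, hypograph, hk]).turingReducible

theorem ComputableWithQueries.charFn_hypograph {X g : ℕ → ℕ} (hmono : Monotone g)
    (htop : Tendsto g atTop atTop) (hg : ComputableWithQueries X Set.Iic g) :
    ComputableWithQueries X (fun m => {q | ∀ k < q, g k ≤ m.unpair.2})
      (charFn (hypograph g)) := by
  have hex : ∀ m : ℕ, ∃ k, IsLeast {k | m.unpair.2 < g k} k := fun m =>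
    ⟨_, isLeast_csInf (htop.eventually_gt_atTop m.unpair.2).exists⟩
  choose κ hκ using hex
  have hfst : Computable fun z : ℕ => z.unpair.1 := Computable.fst.comp Computable.unpair
  have hsnd : Computable fun z : ℕ => z.unpair.2 := Computable.snd.comp Computable.unpair
  have hsub : Computable₂ fun x v : ℕ => v + 1 - x :=
    (Primrec.nat_sub.comp (Primrec.succ.comp Primrec.snd) Primrec.fst).to_comp
  have hbelow : ∀ m, ∀ k < κ m, g k ≤ m.unpair.2 := fun m k hk =>
    not_lt.1 fun h => hk.not_ge ((hκ m).2 h)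
  have htest := computable₂_comp hsub (hg.comp (of_computable X hsnd))
    (of_computable X (hsnd.comp hfst))
  have hsearch := htest.rfind (g := κ)
    (fun m => by simpa using Nat.sub_eq_zero_of_le (Nat.succ_le_of_lt (hκ m).1))
    (fun m k hk => by simpa [Nat.sub_eq_zero_iff_le] using hbelow m k hk)
  have hle : Computable₂ fun k n : ℕ => if k ≤ n then 1 else 0 :=
    (Primrec.ite Primrec.nat_le (Primrec.const 1) (Primrec.const 0)).to_comp
  have hmem : ∀ m, m ∈ hypograph g ↔ κ m ≤ m.unpair.1 := fun m =>
    ⟨fun h => (hκ m).2 h, fun h => (hκ m).1.trans_le (hmono h)⟩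
  have hchar : charFn (hypograph g) = fun m => if κ m ≤ m.unpair.1 then 1 else 0 := by
    funext m
    simp only [charFn, hmem]
  rw [hchar]
  refine (computable₂_comp hle hsearch (of_computable X hfst)).mono fun m q hq k hk => ?_
  obtain ⟨i, hi, hqi⟩ : ∃ i ≤ κ m, q ≤ i := by simpa using hq
  exact hbelow m k (hk.trans_le (hqi.trans hi))

theorem IsOrder.exists_computable_le {h : ℕ → ℕ} (hh : IsOrder h) :
    ∃ p : ℕ → ℕ, Computable p ∧ ∀ k, k ≤ h (p k) := by
  obtain ⟨hcomp, -, hunb⟩ := hh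
  have hex : ∀ k, ∃ n, k ≤ h n := fun k => by
    obtain ⟨_, ⟨n, rfl⟩, hn⟩ := not_bddAbove_iff.1 hunb k
    exact ⟨n, hn.le⟩
  have hsearch : Partrec fun k => Nat.rfind fun n => Part.some (decide (k ≤ h n)) :=
    Partrec.rfind <| Computable.partrec <|
      Primrec.nat_le.decide.to_comp.comp Computable.fst (hcomp.comp Computable.snd)
  refine ⟨fun k => Nat.find (hex k), hsearch.of_eq fun k => Part.eq_some_iff.2 <|
    Nat.mem_rfind.2 ⟨?_, fun hn => ?_⟩, fun k => Nat.find_spec (hex k)⟩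
  · simpa using Nat.find_spec (hex k)
  · simpa using Nat.find_min (hex k) hn

theorem IsDominant.tendsto_atTop {f : ℕ → ℕ} (hf : IsDominant f) : Tendsto f atTop atTop :=
  tendsto_atTop_mono' atTop (hf id Computable.id) tendsto_id

theorem IsDominant.uniformTinyUseReducible {A B : Set ℕ} {g : ℕ → ℕ} (hg : IsDominant g)
    (hA : ComputableWithQueries (charFn B) (fun m => {q | ∀ k < q, g k ≤ m}) (charFn A)) :
    UniformTinyUseReducible A B := by
  obtain ⟨c, hc, hq⟩ := hA
  refine ⟨c, hc, fun h hh => ?_⟩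
  obtain ⟨p, hp, hhp⟩ := hh.exists_computable_le
  have hle : ∀ {k n}, p k ≤ n → k ≤ h n := fun hkn => (hhp _).trans (hh.2.1 hkn)
  obtain ⟨N, hN⟩ := eventually_atTop.1 <| hg (fun k => p (k + 2)) <|
    hp.comp (Computable.succ.comp Computable.succ)
  filter_upwards [eventually_ge_atTop (p (N + 1))] with n hn
  refine use_le fun m hm q hqm => ?_
  rcases le_or_gt q N with hqN | hNq
  · exact Nat.lt_of_succ_le ((Nat.succ_le_succ hqN).trans (hle hn))
  · obtain ⟨k, rfl⟩ := Nat.exists_eq_add_one_of_ne_zero hNq.ne_bot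
    exact Nat.lt_of_succ_le <| hle <| (hN k (Nat.le_of_lt_succ hNq)).trans <|
      (hq m hqm k k.lt_succ_self).trans hm.le

theorem mainTheorem10 (a j : TuringDegree)
    (hj : IsLUB {a, degT (jump ∅)} j)
    (h : degT (jump (jump ∅)) ≤ j)
    (B : Set ℕ) (hB : degT B = a) :
    (∃ A : Set ℕ, degT A = a ∧ UniformTinyUseReducible A B) ∧
      ∃ f : ℕ → ℕ, IsDominant f ∧ WttEquivalent f (charFn B) := by
  subst hB
  obtain ⟨K, hprim, hK⟩ := exists_primrec₂_eventually_eq_charFn rePred_mem_jump_empty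
  have htotal : TuringReducible (charFn totalCodes : ℕ →. ℕ)
      (joinFn (charFn B) (charFn (jump ∅)) : ℕ →. ℕ) :=
    (turingReducible_charFn_of_notMem_manyOneReducible
      notMem_totalCodes_manyOneReducible_jump_jump).trans (turingReducible_joinFn_of_isLUB hj h)
  obtain ⟨Γ, hΓ⟩ := (exists_code_iff _ _).2 htotal
  obtain ⟨f, hf, hfdom, hfB⟩ := exists_monotone_isDominant hprim hK (congrFun hΓ)
  obtain ⟨g, hg, hgdom, hgB, hmod⟩ := exists_monotone_isDominant_mod_two hf hfdom hfB
  have hBg : ComputableWithQueries g Set.Iic (charFn B) := by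
    have hmod2 : Computable fun x => x % 2 :=
      (Primrec.nat_mod.comp Primrec.id (Primrec.const 2)).to_comp
    simpa only [hmod] using ((oracle g).computable_comp hmod2).mono fun n => by simp
  have hA := hgB.charFn_hypograph hg hgdom.tendsto_atTop
  refine ⟨⟨hypograph g, le_antisymm hA.turingReducible
    (hBg.turingReducible.trans (turingReducible_charFn_hypograph g)),
    hgdom.uniformTinyUseReducible (hA.mono fun m q hq k hk => ?_)⟩,
    g, hgdom, hgB.wttReducible, hBg.wttReducible⟩
  exact (hq k hk).trans m.unpair_right_le
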